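/- A \emph{skew brace} is a set $A$ with two group structures $(A,+)$ and $(A,\circ)$ (not assumed commutative) such that $a\circ(b+c)=a\circ b-a+a\circ c$ for all $a,b,c\in A$. Put $\lambda_a(b)=-a+a\circ b$, $a*b=-a+a\circ b-b$ and $[a,b]_+=a+b-a-b$. Let $\operatorname{Soc}(A)=\ker\lambda\cap Z(A,+)$ and $\operatorname{Ann}(A)=\operatorname{Soc}(A)\cap Z(A,\circ)$, and let $A'$ be the additive subgroup generated by all $[a,b]_+$ and all $a*b$; $\operatorname{Ann}(A)$ is an ideal and $A'$ is a sub skew brace. Skew braces $A$ and $B$ are \emph{isoclinic} if there are skew brace isomorphisms $\xi\colon A/\operatorname{Ann}(A)\to B/\operatorname{Ann}(B)$ and $\theta\colon A'\to B'$ such that, whenever $\xi(\overline{a})=\overline{b}$ and $\xi(\overline{a_1})=\overline{b_1}$, one has $\theta([a,a_1]_+)=[b,b_1]_+$ and $\theta(a*a_1)=b*b_1$. A \emph{finite non-degenerate solution} $(X,r)$ of the Yang--Baxter equation is a finite non-empty set $X$ with a bijection $r\colon X\times X\to X\times X$, $r(x,y)=(\sigma_x(y),\tau_y(x))$, satisfying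 $(r\times\mathrm{id})(\mathrm{id}\times r)(r\times\mathrm{id})=(\mathrm{id}\times r)(r\times\mathrm{id})(\mathrm{id}\times r)$ and such that all maps $\sigma_x$ and $\tau_x$ are bijective. Its retraction $\operatorname{Ret}(X,r)$ is the solution induced by $r$ on the set of classes of the equivalence relation $x\sim y\Leftrightarrow(\sigma_x=\sigma_y\text{ and }\tau_x=\tau_y)$; $(X,r)$ is \emph{multipermutation} if $|\operatorname{Ret}^m(X,r)|=1$ for some $m\ge 1$. Its \emph{permutation skew brace} $\mathcal{G}(X,r)$ is the group generated by the pairs $g_x=(\sigma_x,\tau_x^{-1})\in\operatorname{Sym}(X)\times\operatorname{Sym}(X)$, $x\in X$, as circle group, with the unique addition that makes it a skew brace satisfying $\lambda_g(g_y)=g_{\sigma(g)(y)}$ for all $g\in\mathcal{G}(X,r)$ and $y\in X$, where $\sigma(g)$ denotes the first component of $g$. \textbf{Theorem.} Let $(X,r)$ and $(Y,s)$ be finite non-degenerate solutions of the Yang--Baxter equation that are permutation isoclinic, that is, the skew braces $\mathcal{G}(X,r)$ and $\mathcal{G}(Y,s)$ are isoclinic. Then $(X,r)$ is multipermutation if and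 only if $(Y,s)$ is multipermutation. -/

import Mathlib

/-! ## Skew braces -/

/-- A skew brace: an additive group and a multiplicative group (the circle operation, here `*`)
on the same type, neither of them assumed commutative, with
`a ∘ (b + c) = a ∘ b - a + a ∘ c`. -/
class SkewBrace (A : Type*) extends AddGroup A, Group A where
  mul_add_compat : ∀ a b c : A, a * (b + c) = a * b - a + a * c

namespace SkewBrace

section Basic

variable {A : Type*} [SkewBrace A]

/-- The map `λ_a(b) = -a + a ∘ b`. -/
def lam (a b : A) : A := -a + a * b

/-- The star operation `a * b = -a + a ∘ b - b` of a skew brace. -/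
def star (a b : A) : A := -a + a * b - b

/-- The additive commutator `[a, b]_+ = a + b - a - b`. -/
def addComm (a b : A) : A := a + b - a - b

theorem mul_eq_add_lam (a b : A) : a * b = a + lam a b := by simp [lam]

theorem zero_eq_one : (0 : A) = 1 := by
  have h := mul_add_compat (1 : A) 0 0
  simp only [one_mul, add_zero, zero_sub] at h
  have h2 : (1 : A) = 0 := by simpa using h.symm
  exact h2.symm

theorem mul_zero_eq (a : A) : a * 0 = a := by rw [zero_eq_one, mul_one]

theorem lam_add (a b c : A) : lam a (b + c) = lam a b + lam a c := by
  simp only [lam, mul_add_compat, sub_eq_add_neg, add_assoc]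

theorem lam_neg (a b : A) : lam a (-b) = -lam a b := by
  have h : lam a (-b) + lam a b = 0 := by
    rw [← lam_add, neg_add_cancel, lam, mul_zero_eq, neg_add_cancel]
  exact eq_neg_of_add_eq_zero_left h

theorem lam_zero (a : A) : lam a 0 = 0 := by rw [lam, mul_zero_eq, neg_add_cancel]

theorem lam_mul (a b c : A) : lam (a * b) c = lam a (lam b c) := by
  have h := mul_add_compat a b (lam b c)
  rw [← mul_eq_add_lam, ← mul_assoc, mul_eq_add_lam (a * b) c, sub_eq_add_neg, add_assoc] at h
  exact add_left_cancel h

theorem lam_one (b : A) : lam (1 : A) b = b := by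
  rw [lam, one_mul, ← zero_eq_one, neg_zero, zero_add]

theorem inv_eq (a : A) : a⁻¹ = -lam a⁻¹ a := by
  have h : a⁻¹ + lam a⁻¹ a = 0 := by rw [← mul_eq_add_lam, inv_mul_cancel, zero_eq_one]
  exact eq_neg_of_add_eq_zero_left h

end Basic

/-! ### Sub skew braces, the commutator -/

/-- An additive subgroup closed under the circle operation and circle inverses is a skew brace. -/
abbrev ofAddSubgroup {A : Type*} [SkewBrace A] (H : AddSubgroup A)
    (hmul : ∀ a ∈ H, ∀ b ∈ H, a * b ∈ H) (hinv : ∀ a ∈ H, a⁻¹ ∈ H) : SkewBrace H where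
  __ := (inferInstance : AddGroup H)
  mul a b := ⟨a.1 * b.1, hmul _ a.2 _ b.2⟩
  one := ⟨1, zero_eq_one (A := A) ▸ H.zero_mem⟩
  inv a := ⟨a.1⁻¹, hinv _ a.2⟩
  mul_assoc a b c := Subtype.ext (mul_assoc a.1 b.1 c.1)
  one_mul a := Subtype.ext (one_mul a.1)
  mul_one a := Subtype.ext (mul_one a.1)
  inv_mul_cancel a := Subtype.ext (inv_mul_cancel a.1)
  mul_add_compat a b c := Subtype.ext (mul_add_compat a.1 b.1 c.1)

/-- The commutator of a skew brace: the additive subgroup generated by all additive commutators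
`[a, b]_+` and all `a * b` (star operation). -/
def commutator (A : Type*) [SkewBrace A] : AddSubgroup A :=
  AddSubgroup.closure ({x | ∃ a b : A, addComm a b = x} ∪ {x | ∃ a b : A, star a b = x})

section Commutator

variable {A : Type*} [SkewBrace A]

theorem addComm_mem_commutator (a b : A) : addComm a b ∈ commutator A :=
  AddSubgroup.subset_closure (Or.inl ⟨a, b, rfl⟩)

theorem star_mem_commutator (a b : A) : star a b ∈ commutator A :=
  AddSubgroup.subset_closure (Or.inr ⟨a, b, rfl⟩)

theorem lam_mem_commutator (a : A) {x : A} (hx : x ∈ commutator A) : lam a x ∈ commutator A := by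
  have h : lam a x = star a x + x := by simp [lam, star]
  rw [h]
  exact add_mem (star_mem_commutator a x) hx

end Commutator

/-- The commutator is a sub skew brace. -/
instance (A : Type*) [SkewBrace A] : SkewBrace (commutator A) :=
  ofAddSubgroup (commutator A)
    (fun a ha b hb => by
      rw [mul_eq_add_lam]; exact add_mem ha (lam_mem_commutator a hb))
    (fun a ha => by
      rw [inv_eq]; exact neg_mem (lam_mem_commutator a⁻¹ ha))

/-! ### Socle, annihilator and the quotient by the annihilator -/

/-- The socle `ker λ ∩ Z(A, +)`. -/
def socle (A : Type*) [SkewBrace A] : AddSubgroup A where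
  carrier := {a | (∀ b, lam a b = b) ∧ ∀ b, a + b = b + a}
  zero_mem' := ⟨fun b => by rw [zero_eq_one, lam_one], fun b => by simp⟩
  add_mem' := by
    rintro a b ⟨ha, ha'⟩ ⟨hb, hb'⟩
    refine ⟨fun c => ?_, fun c => ?_⟩
    · have h : a + b = a * b := by rw [mul_eq_add_lam, ha]
      rw [h, lam_mul, hb, ha]
    · rw [add_assoc, hb', ← add_assoc, ha', add_assoc]
  neg_mem' := by
    rintro a ⟨ha, ha'⟩
    have hinv : ∀ c, lam a⁻¹ c = c := fun c => by
      have h := lam_mul a⁻¹ a c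
      rw [inv_mul_cancel, lam_one, ha] at h
      exact h.symm
    have h : -a = a⁻¹ := by rw [inv_eq, hinv]
    refine ⟨fun c => ?_, fun c => ?_⟩
    · rw [h, hinv]
    · exact (AddCommute.neg_left (ha' c : AddCommute a c))

/-- The annihilator `Soc(A) ∩ Z(A, ∘)`. -/
def annihilator (A : Type*) [SkewBrace A] : AddSubgroup A where
  carrier := {a | a ∈ socle A ∧ ∀ b, a * b = b * a}
  zero_mem' := ⟨(socle A).zero_mem, fun b => by rw [zero_eq_one, one_mul, mul_one]⟩
  add_mem' := by
    rintro a b ⟨ha, ha'⟩ ⟨hb, hb'⟩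
    refine ⟨add_mem ha hb, fun c => ?_⟩
    have h : a + b = a * b := by rw [mul_eq_add_lam, ha.1]
    rw [h, mul_assoc, hb', ← mul_assoc, ha', mul_assoc]
  neg_mem' := by
    rintro a ⟨ha, ha'⟩
    refine ⟨neg_mem ha, fun c => ?_⟩
    have h : -a = a⁻¹ := by
      have h1 : a * (-a) = 1 := by rw [mul_eq_add_lam, ha.1, add_neg_cancel, zero_eq_one]
      exact eq_inv_of_mul_eq_one_right h1
    rw [h]
    exact (Commute.inv_left (ha' c : Commute a c))

section Annihilator

variable {A : Type*} [SkewBrace A]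

instance annihilator_normal : (annihilator A).Normal where
  conj_mem n hn g := by
    rw [← hn.1.2 g, add_neg_cancel_right]; exact hn

/-- Two elements are congruent modulo the annihilator iff they differ by (right) addition of an
annihilator element. -/
theorem exists_add_of_leftRel {a b : A}
    (h : QuotientAddGroup.leftRel (annihilator A) a b) : ∃ z ∈ annihilator A, b = a + z :=
  ⟨-a + b, QuotientAddGroup.leftRel_apply.mp h, by simp⟩

theorem add_eq_mul_of_mem {z : A} (hz : z ∈ annihilator A) (a : A) : a + z = a * z := by
  rw [← hz.2 a, mul_eq_add_lam, hz.1.1, hz.1.2]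

theorem add_mul_add_ann {z w : A} (hz : z ∈ annihilator A) (hw : w ∈ annihilator A) (a b : A) :
    (a + z) * (b + w) = a * b + (z + w) := by
  have hzw : z + w ∈ annihilator A := add_mem hz hw
  rw [add_eq_mul_of_mem hz, add_eq_mul_of_mem hw, add_eq_mul_of_mem hzw, add_eq_mul_of_mem hw]
  rw [mul_assoc, ← mul_assoc z, hz.2 b]
  simp only [mul_assoc]

theorem inv_add_ann {z : A} (hz : z ∈ annihilator A) (a : A) : (a + z)⁻¹ = a⁻¹ + -z := by
  have h : -z = z⁻¹ := by
    have h1 : z * (-z) = 1 := by rw [mul_eq_add_lam, hz.1.1, add_neg_cancel, zero_eq_one]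
    exact eq_inv_of_mul_eq_one_right h1
  rw [add_eq_mul_of_mem (neg_mem hz), h, add_eq_mul_of_mem hz, mul_inv_rev]
  exact (Commute.inv_inv (hz.2 a : Commute z a)).eq

theorem star_add_ann {z w : A} (hz : z ∈ annihilator A) (hw : w ∈ annihilator A) (a b : A) :
    star (a + z) (b + w) = star a b := by
  have h : -a + (a * b + z) = z + (-a + a * b) := by rw [← add_assoc, hz.1.2]
  calc star (a + z) (b + w) = -z + (-a + (a * b + z)) + -b := by
        rw [star, add_mul_add_ann hz hw]; simp [sub_eq_add_neg, add_assoc]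
    _ = star a b := by rw [h]; simp [star, sub_eq_add_neg, add_assoc]

theorem addComm_add_ann {z w : A} (hz : z ∈ annihilator A) (hw : w ∈ annihilator A) (a b : A) :
    addComm (a + z) (b + w) = addComm a b := by
  calc addComm (a + z) (b + w) = a + (z + b) + (w + (-z + -a)) + (-w + -b) := by
        simp [addComm, sub_eq_add_neg, add_assoc]
    _ = addComm a b := by
        rw [hz.1.2 b, hw.1.2 (-z + -a)]; simp [addComm, sub_eq_add_neg, add_assoc]

/-- The quotient of a skew brace by its annihilator, with the operations induced from `A`. -/
instance (A : Type*) [SkewBrace A] : SkewBrace (A ⧸ annihilator A) where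
  __ := (inferInstance : AddGroup (A ⧸ annihilator A))
  mul := Quotient.map₂ (fun a b => a * b) (by
    intro a a' ha b b' hb
    obtain ⟨z, hz, rfl⟩ := exists_add_of_leftRel ha
    obtain ⟨w, hw, rfl⟩ := exists_add_of_leftRel hb
    refine QuotientAddGroup.leftRel_apply.mpr ?_
    rw [add_mul_add_ann hz hw, neg_add_cancel_left]
    exact add_mem hz hw)
  one := Quotient.mk _ 1
  inv := Quotient.map (fun a => a⁻¹) (by
    intro a a' ha
    obtain ⟨z, hz, rfl⟩ := exists_add_of_leftRel ha
    refine QuotientAddGroup.leftRel_apply.mpr ?_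
    rw [inv_add_ann hz, neg_add_cancel_left]
    exact neg_mem hz)
  mul_assoc := by
    rintro ⟨a⟩ ⟨b⟩ ⟨c⟩; exact congrArg (Quotient.mk _) (mul_assoc a b c)
  one_mul := by rintro ⟨a⟩; exact congrArg (Quotient.mk _) (one_mul a)
  mul_one := by rintro ⟨a⟩; exact congrArg (Quotient.mk _) (mul_one a)
  inv_mul_cancel := by rintro ⟨a⟩; exact congrArg (Quotient.mk _) (inv_mul_cancel a)
  mul_add_compat := by
    rintro ⟨a⟩ ⟨b⟩ ⟨c⟩; exact congrArg (Quotient.mk _) (mul_add_compat a b c)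

end Annihilator

/-! ### Isoclinism -/

/-- The map `(A / Ann A)² → A'`, `(a, b) ↦ [a, b]_+`. -/
def phiAdd (A : Type*) [SkewBrace A] :
    A ⧸ annihilator A → A ⧸ annihilator A → commutator A :=
  Quotient.lift₂ (fun a b => ⟨addComm a b, addComm_mem_commutator a b⟩) (by
    intro a b a' b' ha hb
    obtain ⟨z, hz, rfl⟩ := exists_add_of_leftRel ha
    obtain ⟨w, hw, rfl⟩ := exists_add_of_leftRel hb
    exact Subtype.ext (addComm_add_ann hz hw a b).symm)

/-- The map `(A / Ann A)² → A'`, `(a, b) ↦ a * b` (star operation). -/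
def phiStar (A : Type*) [SkewBrace A] :
    A ⧸ annihilator A → A ⧸ annihilator A → commutator A :=
  Quotient.lift₂ (fun a b => ⟨star a b, star_mem_commutator a b⟩) (by
    intro a b a' b' ha hb
    obtain ⟨z, hz, rfl⟩ := exists_add_of_leftRel ha
    obtain ⟨w, hw, rfl⟩ := exists_add_of_leftRel hb
    exact Subtype.ext (star_add_ann hz hw a b).symm)

/-- Two skew braces are isoclinic if there are skew brace isomorphisms
`ξ : A / Ann A → B / Ann B` and `θ : A' → B'` compatible with the maps `phiAdd` and `phiStar`.
(`≃+*` denotes bijections preserving both `+` and `*`, i.e. skew brace isomorphisms.) -/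
def Isoclinic (A B : Type*) [SkewBrace A] [SkewBrace B] : Prop :=
  ∃ (ξ : (A ⧸ annihilator A) ≃+* (B ⧸ annihilator B)) (θ : commutator A ≃+* commutator B),
    (∀ a b, θ (phiAdd A a b) = phiAdd B (ξ a) (ξ b)) ∧
    (∀ a b, θ (phiStar A a b) = phiStar B (ξ a) (ξ b))

end SkewBrace

/-! ## Set-theoretic solutions of the Yang–Baxter equation -/

/-- `r × id` on `X × X × X`. -/
def ybLeft {X : Type*} (r : X × X → X × X) : X × X × X → X × X × X :=
  fun p => ((r (p.1, p.2.1)).1, (r (p.1, p.2.1)).2, p.2.2)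

/-- `id × r` on `X × X × X`. -/
def ybRight {X : Type*} (r : X × X → X × X) : X × X × X → X × X × X :=
  fun p => (p.1, r p.2)

/-- A (bijective) non-degenerate set-theoretic solution `r(x, y) = (σ_x(y), τ_y(x))` of the
Yang–Baxter equation on `X`. -/
structure YBSolution (X : Type*) where
  r : X × X → X × X
  bijective : Function.Bijective r
  yang_baxter : ybLeft r ∘ ybRight r ∘ ybLeft r = ybRight r ∘ ybLeft r ∘ ybRight r
  sigma_bijective : ∀ x, Function.Bijective fun y => (r (x, y)).1
  tau_bijective : ∀ y, Function.Bijective fun x => (r (x, y)).2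

namespace YBSolution

section

variable {X : Type*} (S : YBSolution X)

/-- The permutation `σ_x`, `r(x, y) = (σ_x(y), τ_y(x))`. -/
noncomputable def sigma (x : X) : Equiv.Perm X := Equiv.ofBijective _ (S.sigma_bijective x)

/-- The permutation `τ_y`, `r(x, y) = (σ_x(y), τ_y(x))`. -/
noncomputable def tau (y : X) : Equiv.Perm X := Equiv.ofBijective _ (S.tau_bijective y)

theorem r_apply (x y : X) : S.r (x, y) = (S.sigma x y, S.tau y x) := rfl

theorem sigma_sigma (x y : X) :
    S.sigma (S.sigma x y) * S.sigma (S.tau y x) = S.sigma x * S.sigma y := by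
  ext z
  have h := congrFun S.yang_baxter (x, y, z)
  simp only [ybLeft, ybRight, Function.comp, r_apply, Prod.mk.injEq] at h
  exact h.1

theorem tau_tau (x y : X) :
    S.tau (S.tau y x) * S.tau (S.sigma x y) = S.tau y * S.tau x := by
  ext z
  have h := congrFun S.yang_baxter (z, x, y)
  simp only [ybLeft, ybRight, Function.comp, r_apply, Prod.mk.injEq] at h
  exact h.2.2.symm

/-! ### Retraction and multipermutation solutions -/

/-- The equivalence relation `x ∼ y ↔ σ_x = σ_y ∧ τ_x = τ_y`. -/
def retSetoid : Setoid X where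
  r x y := S.sigma x = S.sigma y ∧ S.tau x = S.tau y
  iseqv :=
    ⟨fun _ => ⟨rfl, rfl⟩, fun h => ⟨h.1.symm, h.2.symm⟩,
      fun h h' => ⟨h.1.trans h'.1, h.2.trans h'.2⟩⟩

theorem sigma_rel {x x' y y' : X} (hx : S.retSetoid x x') (hy : S.retSetoid y y') :
    S.retSetoid (S.sigma x y) (S.sigma x' y') := by
  have ht : S.tau y x = S.tau y' x := by rw [hy.2]
  rw [← hx.1]
  constructor
  · have h := S.sigma_sigma x y
    rw [ht, hy.1, ← S.sigma_sigma x y'] at h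
    exact mul_right_cancel h
  · have h := S.tau_tau x y
    rw [ht, hy.2, ← S.tau_tau x y'] at h
    exact mul_left_cancel h

theorem tau_rel {x x' y y' : X} (hx : S.retSetoid x x') (hy : S.retSetoid y y') :
    S.retSetoid (S.tau y x) (S.tau y' x') := by
  have ht : S.sigma x y = S.sigma x' y := by rw [hx.1]
  rw [← hy.2]
  constructor
  · have h := S.sigma_sigma x y
    rw [ht, hx.1, ← S.sigma_sigma x' y] at h
    exact mul_left_cancel h
  · have h := S.tau_tau x y
    rw [ht, hx.2, ← S.tau_tau x' y] at h
    exact mul_right_cancel h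

/-- The map induced by `r` on the set of equivalence classes. -/
noncomputable def retMap (p : Quotient S.retSetoid × Quotient S.retSetoid) :
    Quotient S.retSetoid × Quotient S.retSetoid :=
  (Quotient.map₂ (fun x y => (S.r (x, y)).1) (fun _ _ hx _ _ hy => S.sigma_rel hx hy) p.1 p.2,
   Quotient.map₂ (fun x y => (S.r (x, y)).2) (fun _ _ hx _ _ hy => S.tau_rel hx hy) p.1 p.2)

theorem retMap_mk (x y : X) :
    S.retMap (Quotient.mk _ x, Quotient.mk _ y) =
      (Quotient.mk _ (S.r (x, y)).1, Quotient.mk _ (S.r (x, y)).2) := rfl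

/-- The retraction `Ret(X, r)` of a finite solution: the induced solution on classes. -/
noncomputable def ret [Finite X] : YBSolution (Quotient S.retSetoid) where
  r := S.retMap
  bijective := by
    refine Finite.injective_iff_bijective.mp (Finite.injective_iff_surjective.mpr ?_)
    rintro ⟨⟨x⟩, ⟨y⟩⟩
    obtain ⟨⟨a, b⟩, h⟩ := S.bijective.surjective (x, y)
    refine ⟨(Quotient.mk _ a, Quotient.mk _ b), ?_⟩
    rw [retMap_mk, h]; rfl
  yang_baxter := by
    funext p
    obtain ⟨⟨x⟩, ⟨y⟩, ⟨z⟩⟩ := p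
    have h := congrFun S.yang_baxter (x, y, z)
    exact congrArg (fun q : X × X × X =>
      ((Quotient.mk S.retSetoid q.1, Quotient.mk S.retSetoid q.2.1,
        Quotient.mk S.retSetoid q.2.2) : _ × _ × _)) h
  sigma_bijective := by
    rintro ⟨x⟩
    refine Finite.injective_iff_bijective.mp (Finite.injective_iff_surjective.mpr ?_)
    rintro ⟨y⟩
    obtain ⟨a, h⟩ := (S.sigma_bijective x).surjective y
    exact ⟨Quotient.mk _ a, congrArg (Quotient.mk _) h⟩
  tau_bijective := by
    rintro ⟨x⟩
    refine Finite.injective_iff_bijective.mp (Finite.injective_iff_surjective.mpr ?_)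
    rintro ⟨y⟩
    obtain ⟨a, h⟩ := (S.tau_bijective x).surjective y
    exact ⟨Quotient.mk _ a, congrArg (Quotient.mk _) h⟩

end

end YBSolution

/-- A finite non-degenerate solution together with its underlying set (used only to iterate the
retraction, which changes the underlying set). -/
structure FiniteYBSolution where
  carrier : Type*
  finite : Finite carrier
  sol : YBSolution carrier

/-- The retraction, on bundled solutions. -/
noncomputable def FiniteYBSolution.ret (S : FiniteYBSolution) : FiniteYBSolution :=
  haveI := S.finite
  ⟨Quotient S.sol.retSetoid, inferInstance, S.sol.ret⟩

namespace YBSolution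

/-- `(X, r)` is multipermutation if `|Ret^m(X, r)| = 1` for some `m ≥ 1`. -/
def IsMultipermutation {X : Type*} [Finite X] (S : YBSolution X) : Prop :=
  ∃ m : ℕ, 1 ≤ m ∧ Nat.card (FiniteYBSolution.ret^[m] ⟨X, inferInstance, S⟩).carrier = 1

/-! ### The permutation skew brace -/

section PermGroup

variable {X : Type*} (S : YBSolution X)

/-- The permutation group `𝒢(X, r)`: the group generated by the pairs `(σ_x, τ_x⁻¹)`, `x ∈ X`. -/
noncomputable def permGroup : Subgroup (Equiv.Perm X × Equiv.Perm X) :=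
  Subgroup.closure (Set.range fun x => (S.sigma x, (S.tau x)⁻¹))

/-- The generator `(σ_x, τ_x⁻¹)` of `𝒢(X, r)`. -/
noncomputable def gen (x : X) : S.permGroup :=
  ⟨(S.sigma x, (S.tau x)⁻¹), Subgroup.subset_closure ⟨x, rfl⟩⟩

theorem gen_mul_gen (x y : X) :
    S.gen (S.sigma x y) * S.gen (S.tau y x) = S.gen x * S.gen y := by
  refine Subtype.ext (Prod.ext (S.sigma_sigma x y) ?_)
  have h := congrArg (·⁻¹) (S.tau_tau x y)
  simpa [gen, mul_inv_rev] using h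

/-- The map `g ↦ g ∘ g_{σ(g)⁻¹(y)}`, which will be right addition of the generator `g_y`. -/
noncomputable def addGen (y : X) : Function.End S.permGroup :=
  fun g => g * S.gen (g.1.1⁻¹ y)

/-- An auxiliary map (left addition of the circle inverse of `g_x`). -/
noncomputable def leftGen (x : X) : Function.End S.permGroup :=
  fun g => g * (S.gen (g.1.2⁻¹ x))⁻¹

theorem addGen_leftGen (x y : X) (g : S.permGroup) :
    S.addGen y (S.leftGen x g) = S.leftGen x (S.addGen y g) := by
  have h := S.gen_mul_gen (g.1.2⁻¹ x) (g.1.1⁻¹ y)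
  have h1 : (S.leftGen x g).1.1⁻¹ y = S.sigma (g.1.2⁻¹ x) (g.1.1⁻¹ y) := by
    simp [leftGen, gen, mul_inv_rev]
  have h2 : (S.addGen y g).1.2⁻¹ x = S.tau (g.1.1⁻¹ y) (g.1.2⁻¹ x) := by
    simp [addGen, gen, mul_inv_rev]
  change S.leftGen x g * S.gen ((S.leftGen x g).1.1⁻¹ y) =
    S.addGen y g * (S.gen ((S.addGen y g).1.2⁻¹ x))⁻¹
  rw [h1, h2]
  change g * (S.gen (g.1.2⁻¹ x))⁻¹ * _ = g * S.gen (g.1.1⁻¹ y) * _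
  rw [mul_assoc, mul_assoc]
  congr 1
  rw [inv_mul_eq_iff_eq_mul, ← mul_assoc, eq_mul_inv_iff_mul_eq]
  exact h

/-- The maps generated by all `addGen y` under composition. -/
noncomputable def addMaps : Submonoid (Function.End S.permGroup) :=
  Submonoid.closure (Set.range S.addGen)

/-- The maps generated by all `leftGen x` under composition. -/
noncomputable def leftMaps : Submonoid (Function.End S.permGroup) :=
  Submonoid.closure (Set.range S.leftGen)

theorem addMaps_comm {n m : Function.End S.permGroup} (hn : n ∈ S.addMaps)
    (hm : m ∈ S.leftMaps) (g : S.permGroup) : n (m g) = m (n g) := by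
  have hgen : ∀ y, ∀ m ∈ S.leftMaps, ∀ g, S.addGen y (m g) = m (S.addGen y g) := by
    intro y m hm
    induction hm using Submonoid.closure_induction with
    | mem m hm => obtain ⟨x, rfl⟩ := hm; exact S.addGen_leftGen x y
    | one => intro g; rfl
    | mul a b _ _ ha hb =>
      intro g
      change S.addGen y (a (b g)) = a (b (S.addGen y g))
      rw [ha, hb]
  induction hn using Submonoid.closure_induction generalizing g with
  | mem n hn => obtain ⟨y, rfl⟩ := hn; exact hgen y m hm g
  | one => rfl
  | mul a b _ _ ha hb =>
    change a (b (m g)) = m (a (b g))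
    rw [hb, ha]

theorem addMaps_conj {n : Function.End S.permGroup} (hn : n ∈ S.addMaps) (h : S.permGroup) :
    ∃ n' ∈ S.addMaps, ∀ g, h * n g = n' (h * g) := by
  induction hn using Submonoid.closure_induction with
  | mem n hn =>
    obtain ⟨y, rfl⟩ := hn
    refine ⟨S.addGen (h.1.1 y), Submonoid.subset_closure ⟨_, rfl⟩, fun g => ?_⟩
    simp [addGen, mul_assoc, mul_inv_rev]
  | one => exact ⟨1, one_mem _, fun g => rfl⟩
  | mul a b _ _ ha hb =>
    obtain ⟨a', ha', ha⟩ := ha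
    obtain ⟨b', hb', hb⟩ := hb
    refine ⟨a' * b', mul_mem ha' hb', fun g => ?_⟩
    change h * a (b g) = a' (b' (h * g))
    rw [ha, hb]

variable [Finite X]

theorem permGroup_induction {p : S.permGroup → Prop} (hgen : ∀ x, p (S.gen x)) (hone : p 1)
    (hmul : ∀ a b, p a → p b → p (a * b)) (g : S.permGroup) : p g := by
  have hpow : ∀ a, p a → ∀ k : ℕ, p (a ^ k) := by
    intro a ha k
    induction k with
    | zero => simpa using hone
    | succ k ih => rw [pow_succ]; exact hmul _ _ ih ha
  obtain ⟨g, hg⟩ := g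
  induction hg using Subgroup.closure_induction with
  | mem x hx => obtain ⟨x, rfl⟩ := hx; exact hgen x
  | one => exact hone
  | mul a b ha hb iha ihb => exact hmul ⟨a, ha⟩ ⟨b, hb⟩ iha ihb
  | inv a ha iha =>
    have hfin : Finite S.permGroup := inferInstance
    have h := hpow _ iha (orderOf (⟨a, ha⟩ : S.permGroup) - 1)
    have e : (⟨a, ha⟩ : S.permGroup) ^ (orderOf (⟨a, ha⟩ : S.permGroup) - 1) = ⟨a, ha⟩⁻¹ :=
      eq_inv_of_mul_eq_one_left
        (by rw [← pow_succ, Nat.sub_add_cancel (orderOf_pos _), pow_orderOf_eq_one])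
    rw [e] at h
    exact h

theorem exists_addMaps (h k : S.permGroup) : ∃ n ∈ S.addMaps, n h = k := by
  have key : ∀ g h : S.permGroup, ∃ n ∈ S.addMaps, n h = h * g := by
    intro g
    induction g using S.permGroup_induction with
    | hgen x =>
      intro h
      refine ⟨S.addGen (h.1.1 x), Submonoid.subset_closure ⟨_, rfl⟩, ?_⟩
      simp [addGen]
    | hone => intro h; exact ⟨1, one_mem _, (mul_one h).symm⟩
    | hmul a b ha hb =>
      intro h
      obtain ⟨n, hn, e⟩ := ha h
      obtain ⟨m, hm, e'⟩ := hb (h * a)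
      refine ⟨m * n, mul_mem hm hn, ?_⟩
      change m (n h) = _
      rw [e, e', mul_assoc]
  simpa using key (h⁻¹ * k) h

theorem exists_leftMaps (h k : S.permGroup) : ∃ n ∈ S.leftMaps, n h = k := by
  have key : ∀ g h : S.permGroup, ∃ n ∈ S.leftMaps, n h = h * g⁻¹ := by
    intro g
    induction g using S.permGroup_induction with
    | hgen x =>
      intro h
      refine ⟨S.leftGen (h.1.2 x), Submonoid.subset_closure ⟨_, rfl⟩, ?_⟩
      simp [leftGen]
    | hone => intro h; exact ⟨1, one_mem _, by rw [inv_one, mul_one]; rfl⟩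
    | hmul a b ha hb =>
      intro h
      obtain ⟨n, hn, e⟩ := hb h
      obtain ⟨m, hm, e'⟩ := ha (h * b⁻¹)
      refine ⟨m * n, mul_mem hm hn, ?_⟩
      change m (n h) = _
      rw [e, e', mul_inv_rev, mul_assoc]
  simpa using key (k⁻¹ * h) h

theorem addMaps_ext {n m : Function.End S.permGroup} (hn : n ∈ S.addMaps) (hm : m ∈ S.addMaps)
    {g : S.permGroup} (h : n g = m g) : n = m := by
  funext k
  obtain ⟨l, hl, rfl⟩ := S.exists_leftMaps g k
  rw [S.addMaps_comm hn hl, S.addMaps_comm hm hl, h]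

theorem addMaps_surjective {n : Function.End S.permGroup} (hn : n ∈ S.addMaps) :
    Function.Surjective n := by
  intro k
  obtain ⟨l, hl, h⟩ := S.exists_leftMaps (n 1) k
  exact ⟨l 1, by rw [S.addMaps_comm hn hl, h]⟩

/-- Right addition of `b`: the unique element of `addMaps` that maps the identity to `b`. -/
noncomputable def addRight (b : S.permGroup) : Function.End S.permGroup :=
  (S.exists_addMaps 1 b).choose

theorem addRight_mem (b : S.permGroup) : S.addRight b ∈ S.addMaps :=
  (S.exists_addMaps 1 b).choose_spec.1

theorem addRight_one (b : S.permGroup) : S.addRight b 1 = b :=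
  (S.exists_addMaps 1 b).choose_spec.2

theorem addRight_one_left (g : S.permGroup) : S.addRight 1 g = g :=
  congrFun (S.addMaps_ext (S.addRight_mem 1) (one_mem _) (g := 1) (S.addRight_one 1)) g

theorem addRight_addRight (b c g : S.permGroup) :
    S.addRight (S.addRight c b) g = S.addRight c (S.addRight b g) := by
  refine congrFun (S.addMaps_ext (m := S.addRight c * S.addRight b) (S.addRight_mem _)
    (mul_mem (S.addRight_mem c) (S.addRight_mem b)) (g := 1) ?_) g
  change _ = S.addRight c (S.addRight b 1)
  rw [addRight_one, addRight_one]

/-- The additive group of the permutation skew brace: `a + b = addRight b a`. -/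
noncomputable abbrev permAddGroup : AddGroup S.permGroup :=
  letI : Add S.permGroup := ⟨fun a b => S.addRight b a⟩
  letI : Zero S.permGroup := ⟨1⟩
  letI : Neg S.permGroup := ⟨fun b => (S.addMaps_surjective (S.addRight_mem b) 1).choose⟩
  AddGroup.ofLeftAxioms
    (fun a b c => (S.addRight_addRight b c a).symm)
    (fun a => S.addRight_one a)
    (fun a => (S.addMaps_surjective (S.addRight_mem a) 1).choose_spec)

/-- The skew brace structure on the permutation group `𝒢(X, r)`; the circle operation is the
composition of permutations. The addition is the only one making `𝒢(X, r)` a skew brace with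
`λ_g(g_y) = g_{σ(g)(y)}` for all `g` and `y`, where `g_y = (σ_y, τ_y⁻¹)` and `σ(g)` is the first
component of `g`; see `lam_gen` and `permAdd_unique` below. -/
noncomputable instance permSkewBrace : SkewBrace S.permGroup where
  __ := S.permAddGroup
  __ := (inferInstance : Group S.permGroup)
  mul_add_compat h a b := by
    let _ := S.permAddGroup
    obtain ⟨n, hn, e⟩ := S.addMaps_conj (S.addRight_mem b) h
    have hadd : ∀ u v : S.permGroup, u + v = S.addRight v u := fun _ _ => rfl
    have hz : (0 : S.permGroup) = 1 := rfl
    have key : n = S.addRight (h * b) * S.addRight (-h) := by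
      refine S.addMaps_ext hn (mul_mem (S.addRight_mem _) (S.addRight_mem _)) (g := h) ?_
      change n h = S.addRight (h * b) (S.addRight (-h) h)
      rw [← hadd h (-h), add_neg_cancel, hz, addRight_one]
      have := e 1
      rw [addRight_one, mul_one] at this
      exact this.symm
    rw [hadd a b, e, key, sub_eq_add_neg]
    rfl

/-- Right addition of a generator. -/
theorem add_gen (a : S.permGroup) (y : X) : a + S.gen y = a * S.gen (a.1.1⁻¹ y) := by
  change S.addRight (S.gen y) a = S.addGen y a
  refine congrFun (S.addMaps_ext (S.addRight_mem _) (Submonoid.subset_closure ⟨y, rfl⟩)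
    (g := 1) ?_) a
  rw [addRight_one]
  simp [addGen]

theorem lam_gen (g : S.permGroup) (y : X) :
    SkewBrace.lam g (S.gen y) = S.gen (g.1.1 y) := by
  have h := S.add_gen g (g.1.1 y)
  have e : g.1.1⁻¹ (g.1.1 y) = y := by simp
  rw [e] at h
  rw [SkewBrace.lam, ← h, neg_add_cancel_left]

/-- Uniqueness of the addition: any additive group structure `B` on `𝒢(X, r)` whose zero is the
identity and which satisfies `g + g_{σ(g)(y)} = g ∘ g_y`, i.e. `λ_g(g_y) = g_{σ(g)(y)}`, has the
same addition. -/
theorem permAdd_unique (B : AddGroup S.permGroup) (hzero : B.zero = 1)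
    (h : ∀ (g : S.permGroup) (y : X), B.add g (S.gen (g.1.1 y)) = g * S.gen y)
    (a b : S.permGroup) : B.add a b = S.permSkewBrace.toAddGroup.add a b := by
  have key : ∀ n ∈ S.addMaps, ∀ c : S.permGroup, n (B.add a c) = B.add a (n c) := by
    intro n hn
    induction hn using Submonoid.closure_induction with
    | mem n hn =>
      obtain ⟨y, rfl⟩ := hn
      have hy : ∀ g, S.addGen y g = B.add g (S.gen y) := fun g => by
        have h' := h g (g.1.1⁻¹ y)
        have e : g.1.1 (g.1.1⁻¹ y) = y := by simp
        rw [e] at h'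
        exact h'.symm
      intro c
      rw [hy, hy]
      exact B.add_assoc a c (S.gen y)
    | one => intro c; rfl
    | mul u v _ _ hu hv =>
      intro c
      change u (v (B.add a c)) = B.add a (u (v c))
      rw [hv, hu]
  have h1 := key _ (S.addRight_mem b) 1
  have h2 : B.add a 1 = a := hzero ▸ B.add_zero a
  rw [addRight_one, h2] at h1
  exact h1.symm

end PermGroup

/-- Two finite solutions are permutation isoclinic if their permutation skew braces are
isoclinic. -/
def PermutationIsoclinic {X Y : Type*} [Finite X] [Finite Y]
    (S : YBSolution X) (T : YBSolution Y) : Prop :=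
  SkewBrace.Isoclinic S.permGroup T.permGroup

end YBSolution

/-!
Being multipermutation is read off from the permutation skew brace, and the resulting property of
skew braces is visibly an invariant of isoclinism.

For a skew brace `A` let `Soc₀(A) = 0` and let `Socₙ₊₁(A)` consist of the `a` for which all
`star a b` and all `addComm a b` lie in `Socₙ(A)`, so that `Soc₁(A)` is the socle. The
argument has two parts:

* The map `𝒢(X, r) → 𝒢(Ret(X, r))` induced by `X → Ret(X, r)` is a surjective homomorphism of skew
  braces whose kernel is exactly the socle (`retHom_eq_zero_iff`). Consequently `Socₙ₊₁(𝒢(X, r))` is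
  the preimage of `Socₙ(𝒢(Ret(X, r)))` (`retHom_mem_socleSeries_iff`), and
  `𝒢(Retⁿ(X, r)) = 0` if and only if `Socₙ` exhausts `𝒢(X, r)`. A solution on one point has trivial
  permutation skew brace, while a trivial permutation skew brace means that all `σ_x` and `τ_x` are
  the identity, so that the next retraction is a point. Hence `(X, r)` is multipermutation if and
  only if `Socₙ(𝒢(X, r)) = 𝒢(X, r)` for some `n` (`isMultipermutation_iff`).

* If `ξ(ā) = b̄` under an isoclinism, then `a ∈ Socₙ₊₁(A)` implies `b ∈ Socₙ₊₁(B)`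
  (`mem_socleSeries_of_isoclinism`): `θ` transports the vanishing of `star a a₁` and `addComm a a₁`,
  and since `ξ` is a homomorphism, `ξ` again matches `star a a₁` with `star b b₁`, and likewise for
  `addComm`, which makes the induction go through.
-/

/-! ### The socle series and isoclinism -/

namespace SkewBrace

/-- The socle series, `Soc₀(A) = 0` and `Socₙ₊₁(A) / Socₙ(A) = Soc(A / Socₙ(A))`, described
without quotients: `a ∈ Socₙ₊₁(A)` when `star a b` and `addComm a b` lie in `Socₙ(A)` for all
`b`. -/
def socleSeries (A : Type*) [SkewBrace A] : ℕ → Set A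
  | 0 => {0}
  | n + 1 => {a | ∀ b, star a b ∈ socleSeries A n ∧ addComm a b ∈ socleSeries A n}

section

variable {A B : Type*} [SkewBrace A] [SkewBrace B]

theorem star_eq_zero_iff {a b : A} : star a b = 0 ↔ lam a b = b := sub_eq_zero

theorem addComm_eq_zero_iff {a b : A} : addComm a b = 0 ↔ a + b = b + a := by
  rw [addComm, sub_eq_zero, sub_eq_iff_eq_add]

theorem socleSeries_one : socleSeries A 1 = socle A := by
  ext a
  change (∀ b, star a b = 0 ∧ addComm a b = 0) ↔ (∀ b, lam a b = b) ∧ ∀ b, a + b = b + a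
  simp only [star_eq_zero_iff, addComm_eq_zero_iff, forall_and]

theorem isoclinic_symm (h : Isoclinic A B) : Isoclinic B A := by
  obtain ⟨ξ, θ, hadd, hstar⟩ := h
  refine ⟨ξ.symm, θ.symm, fun a b => ?_, fun a b => ?_⟩
  · rw [RingEquiv.symm_apply_eq, hadd, RingEquiv.apply_symm_apply, RingEquiv.apply_symm_apply]
  · rw [RingEquiv.symm_apply_eq, hstar, RingEquiv.apply_symm_apply, RingEquiv.apply_symm_apply]

/-- The statement starts at `Soc₁`: it fails for `Soc₀ = 0`, as `ξ(0)` is also the class of every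
nonzero annihilator element. -/
theorem mem_socleSeries_of_isoclinism
    (ξ : (A ⧸ annihilator A) ≃+* (B ⧸ annihilator B)) (θ : commutator A ≃+* commutator B)
    (hadd : ∀ a b, θ (phiAdd A a b) = phiAdd B (ξ a) (ξ b))
    (hstar : ∀ a b, θ (phiStar A a b) = phiStar B (ξ a) (ξ b)) (n : ℕ) {a : A} {b : B}
    (hab : ξ (QuotientAddGroup.mk a) = QuotientAddGroup.mk b) (ha : a ∈ socleSeries A (n + 1)) :
    b ∈ socleSeries B (n + 1) := by
  have hneg : ∀ x, ξ (-x) = -ξ x := map_neg ξ.toAddEquiv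
  induction n generalizing a b with
  | zero =>
    intro b₁
    obtain ⟨x, hx⟩ := ξ.surjective (QuotientAddGroup.mk b₁)
    obtain ⟨a₁, rfl⟩ := QuotientAddGroup.mk_surjective x
    have hθ : θ 0 = 0 := map_zero θ.toAddEquiv
    have h₁ := hstar a a₁
    have h₂ := hadd a a₁
    rw [hab, hx] at h₁ h₂
    have e₁ : phiStar A a a₁ = 0 := Subtype.ext (ha a₁).1
    have e₂ : phiAdd A a a₁ = 0 := Subtype.ext (ha a₁).2
    rw [e₁, hθ] at h₁
    rw [e₂, hθ] at h₂
    exact ⟨(congrArg Subtype.val h₁).symm, (congrArg Subtype.val h₂).symm⟩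
  | succ n ih =>
    intro b₁
    obtain ⟨x, hx⟩ := ξ.surjective (QuotientAddGroup.mk b₁)
    obtain ⟨a₁, rfl⟩ := QuotientAddGroup.mk_surjective x
    refine ⟨ih ?_ (ha a₁).1, ih ?_ (ha a₁).2⟩
    · change ξ (-QuotientAddGroup.mk a + QuotientAddGroup.mk a * QuotientAddGroup.mk a₁
        - QuotientAddGroup.mk a₁) = -QuotientAddGroup.mk b
        + QuotientAddGroup.mk b * QuotientAddGroup.mk b₁ - QuotientAddGroup.mk b₁
      rw [sub_eq_add_neg, map_add, map_add, hneg, hneg, map_mul, hab, hx, ← sub_eq_add_neg]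
    · change ξ (QuotientAddGroup.mk a + QuotientAddGroup.mk a₁ - QuotientAddGroup.mk a
        - QuotientAddGroup.mk a₁) = QuotientAddGroup.mk b + QuotientAddGroup.mk b₁
        - QuotientAddGroup.mk b - QuotientAddGroup.mk b₁
      simp only [sub_eq_add_neg, map_add, hneg, hab, hx]

theorem exists_socleSeries_eq_univ_of_isoclinic (h : Isoclinic A B)
    (hA : ∃ n, ∀ a : A, a ∈ socleSeries A n) : ∃ n, ∀ b : B, b ∈ socleSeries B n := by
  obtain ⟨ξ, θ, hadd, hstar⟩ := h
  obtain ⟨n, hn⟩ := hA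
  refine ⟨n + 1, fun b => ?_⟩
  obtain ⟨x, hx⟩ := ξ.surjective (QuotientAddGroup.mk b)
  obtain ⟨a, rfl⟩ := QuotientAddGroup.mk_surjective x
  exact mem_socleSeries_of_isoclinism ξ θ hadd hstar n hx fun c => ⟨hn _, hn _⟩

end

end SkewBrace

/-! ### The permutation skew brace of the retraction -/

namespace YBSolution

section

variable {X : Type*} (S : YBSolution X)

theorem retSetoid_iff {x y : X} : S.retSetoid x y ↔ S.gen x = S.gen y := by
  change S.sigma x = S.sigma y ∧ S.tau x = S.tau y ↔ _
  simp [gen, Subtype.ext_iff, Prod.ext_iff]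

variable [Finite X]

theorem add_induction {p : S.permGroup → Prop} (hzero : p 0)
    (hadd : ∀ a y, p a → p (a + S.gen y)) (a : S.permGroup) : p a := by
  have key : ∀ n ∈ S.addMaps, ∀ b, p b → p (n b) := by
    intro n hn
    induction hn using Submonoid.closure_induction with
    | mem n hn =>
      obtain ⟨y, rfl⟩ := hn
      intro b hb
      change p (b * S.gen (b.1.1⁻¹ y))
      rw [← S.add_gen]
      exact hadd b y hb
    | one => exact fun b hb => hb
    | mul u v _ _ hu hv => exact fun b hb => hu _ (hv b hb)
  obtain ⟨n, hn, rfl⟩ := S.exists_addMaps 0 a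
  exact key n hn 0 hzero

/-- The maps `leftGen` are left translations, as they commute with all right translations. -/
theorem inv_gen_add (x : X) (a : S.permGroup) :
    (S.gen x)⁻¹ + a = a * (S.gen (a.1.2⁻¹ x))⁻¹ := by
  have h := S.addMaps_comm (S.addRight_mem a) (Submonoid.subset_closure ⟨x, rfl⟩ :
    S.leftGen x ∈ S.leftMaps) 1
  rw [addRight_one] at h
  have e : S.leftGen x 1 = (S.gen x)⁻¹ := by simp [leftGen]
  rw [e] at h
  exact h

theorem inv_add_induction {p : S.permGroup → Prop} (hzero : p 0)
    (hadd : ∀ x a, p a → p ((S.gen x)⁻¹ + a)) (a : S.permGroup) : p a := by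
  have key : ∀ n ∈ S.leftMaps, ∀ b, p b → p (n b) := by
    intro n hn
    induction hn using Submonoid.closure_induction with
    | mem n hn =>
      obtain ⟨x, rfl⟩ := hn
      intro b hb
      change p (b * (S.gen (b.1.2⁻¹ x))⁻¹)
      rw [← S.inv_gen_add]
      exact hadd x b hb
    | one => exact fun b hb => hb
    | mul u v _ _ hu hv => exact fun b hb => hu _ (hv b hb)
  obtain ⟨n, hn, rfl⟩ := S.exists_leftMaps 0 a
  exact key n hn 0 hzero

/-- The first component of `g` controls `λ_g`; given that, the second component controls additive
commutation with the circle inverses of the generators, which generate the additive group. -/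
theorem mem_socle_iff (g : S.permGroup) :
    g ∈ SkewBrace.socle S.permGroup ↔
      (∀ y, S.gen (g.1.1 y) = S.gen y) ∧ ∀ y, S.gen (g.1.2 y) = S.gen y := by
  constructor
  · rintro ⟨hl, hc⟩
    refine ⟨fun y => by rw [← S.lam_gen, hl], fun y => ?_⟩
    have h := S.inv_gen_add (g.1.2 y) g
    rw [← hc, ← hl (S.gen (g.1.2 y))⁻¹, ← SkewBrace.mul_eq_add_lam,
      Equiv.Perm.coe_inv, Equiv.symm_apply_apply] at h
    exact inv_injective (mul_left_cancel h)
  · rintro ⟨h₁, h₂⟩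
    have hl : ∀ b, SkewBrace.lam g b = b := by
      refine S.add_induction (SkewBrace.lam_zero g) fun a y ha => ?_
      rw [SkewBrace.lam_add, ha, S.lam_gen, h₁]
    refine ⟨hl, S.inv_add_induction (by rw [add_zero, zero_add]) fun x a ha => ?_⟩
    have h := S.inv_gen_add x g
    have e : S.gen (g.1.2⁻¹ x) = S.gen x := by
      rw [← h₂ (g.1.2⁻¹ x), Equiv.Perm.coe_inv, Equiv.apply_symm_apply]
    rw [e, SkewBrace.mul_eq_add_lam, hl] at h
    rw [← add_assoc, ← h, add_assoc, ha, add_assoc]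

theorem ret_tau_mk (x y : X) :
    S.ret.tau (Quotient.mk _ x) (Quotient.mk _ y) = Quotient.mk _ (S.tau x y) := rfl

/-- The pairs of permutations `h` of `Ret(X, r)` and `g` of `X` are compatible with the projection
`X → Ret(X, r)`. -/
def Covers (g : S.permGroup) (h : S.ret.permGroup) : Prop :=
  (∀ y, h.1.1 (Quotient.mk _ y) = Quotient.mk _ (g.1.1 y)) ∧
    ∀ y, h.1.2 (Quotient.mk _ y) = Quotient.mk _ (g.1.2 y)

variable {S}

theorem Covers.eq {g : S.permGroup} {h k : S.ret.permGroup} (hh : S.Covers g h)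
    (hk : S.Covers g k) : h = k := by
  refine Subtype.ext (Prod.ext (Equiv.ext ?_) (Equiv.ext ?_))
  · rintro ⟨y⟩; exact (hh.1 y).trans (hk.1 y).symm
  · rintro ⟨y⟩; exact (hh.2 y).trans (hk.2 y).symm

theorem Covers.mul {g g' : S.permGroup} {h h' : S.ret.permGroup} (hg : S.Covers g h)
    (hg' : S.Covers g' h') : S.Covers (g * g') (h * h') := by
  constructor
  · intro y
    change h.1.1 (h'.1.1 _) = _
    rw [hg'.1, hg.1]; rfl
  · intro y
    change h.1.2 (h'.1.2 _) = _
    rw [hg'.2, hg.2]; rfl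

variable (S)

theorem covers_one : S.Covers 1 1 := ⟨fun _ => rfl, fun _ => rfl⟩

theorem covers_gen (x : X) : S.Covers (S.gen x) (S.ret.gen (Quotient.mk _ x)) := by
  refine ⟨fun y => rfl, fun y => ?_⟩
  change (S.ret.tau (Quotient.mk _ x))⁻¹ _ = Quotient.mk _ ((S.tau x)⁻¹ y)
  rw [Equiv.Perm.inv_eq_iff_eq, ret_tau_mk, Equiv.Perm.coe_inv, Equiv.apply_symm_apply]

theorem exists_covers (g : S.permGroup) : ∃ h, S.Covers g h := by
  induction g using S.permGroup_induction with
  | hgen x => exact ⟨_, S.covers_gen x⟩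
  | hone => exact ⟨_, S.covers_one⟩
  | hmul a b ha hb =>
    obtain ⟨u, hu⟩ := ha
    obtain ⟨v, hv⟩ := hb
    exact ⟨_, hu.mul hv⟩

/-- The map `𝒢(X, r) → 𝒢(Ret(X, r))` induced by the projection `X → Ret(X, r)`. -/
noncomputable def retHom (g : S.permGroup) : S.ret.permGroup := (S.exists_covers g).choose

theorem covers_retHom (g : S.permGroup) : S.Covers g (S.retHom g) :=
  (S.exists_covers g).choose_spec

theorem retHom_gen (x : X) : S.retHom (S.gen x) = S.ret.gen (Quotient.mk _ x) :=
  (S.covers_retHom _).eq (S.covers_gen x)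

theorem retHom_mul (a b : S.permGroup) : S.retHom (a * b) = S.retHom a * S.retHom b :=
  (S.covers_retHom _).eq ((S.covers_retHom a).mul (S.covers_retHom b))

theorem retHom_zero : S.retHom 0 = 0 := (S.covers_retHom _).eq S.covers_one

theorem retHom_add (a b : S.permGroup) : S.retHom (a + b) = S.retHom a + S.retHom b := by
  have hgen : ∀ (c : S.permGroup) y, S.retHom (c + S.gen y) =
      S.retHom c + S.ret.gen (Quotient.mk _ y) := by
    intro c y
    have e : (S.retHom c).1.1⁻¹ (Quotient.mk _ y) = Quotient.mk _ (c.1.1⁻¹ y) := by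
      rw [Equiv.Perm.inv_eq_iff_eq, (S.covers_retHom c).1, Equiv.Perm.coe_inv, Equiv.apply_symm_apply]
    rw [S.add_gen, S.ret.add_gen, retHom_mul, retHom_gen, e]
  induction b using S.add_induction with
  | hzero => rw [retHom_zero, add_zero, add_zero]
  | hadd b y hb => rw [← add_assoc, hgen, hgen, hb, add_assoc]

theorem retHom_neg (a : S.permGroup) : S.retHom (-a) = -S.retHom a :=
  eq_neg_of_add_eq_zero_left (by rw [← retHom_add, neg_add_cancel, retHom_zero])

theorem retHom_surjective : Function.Surjective S.retHom := by
  intro h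
  induction h using S.ret.permGroup_induction with
  | hgen x =>
    obtain ⟨x⟩ := x
    exact ⟨_, S.retHom_gen x⟩
  | hone => exact ⟨0, S.retHom_zero⟩
  | hmul a b ha hb =>
    obtain ⟨u, rfl⟩ := ha
    obtain ⟨v, rfl⟩ := hb
    exact ⟨u * v, S.retHom_mul u v⟩

theorem retHom_star (a b : S.permGroup) :
    S.retHom (SkewBrace.star a b) = SkewBrace.star (S.retHom a) (S.retHom b) := by
  simp only [SkewBrace.star, sub_eq_add_neg, retHom_add, retHom_neg, retHom_mul]

theorem retHom_addComm (a b : S.permGroup) :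
    S.retHom (SkewBrace.addComm a b) = SkewBrace.addComm (S.retHom a) (S.retHom b) := by
  simp only [SkewBrace.addComm, sub_eq_add_neg, retHom_add, retHom_neg]

/-- The kernel of `𝒢(X, r) → 𝒢(Ret(X, r))` is the socle. -/
theorem retHom_eq_zero_iff (g : S.permGroup) :
    S.retHom g = 0 ↔ g ∈ SkewBrace.socle S.permGroup := by
  rw [mem_socle_iff]
  simp only [← retSetoid_iff]
  have hg := S.covers_retHom g
  constructor
  · intro h
    rw [h] at hg
    exact ⟨fun y => Quotient.exact (hg.1 y).symm, fun y => Quotient.exact (hg.2 y).symm⟩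
  · rintro ⟨h₁, h₂⟩
    exact hg.eq ⟨fun y => (Quotient.sound (h₁ y)).symm, fun y => (Quotient.sound (h₂ y)).symm⟩

theorem retHom_mem_socleSeries_iff (n : ℕ) (g : S.permGroup) :
    S.retHom g ∈ SkewBrace.socleSeries S.ret.permGroup n ↔
      g ∈ SkewBrace.socleSeries S.permGroup (n + 1) := by
  induction n generalizing g with
  | zero =>
    rw [SkewBrace.socleSeries_one]
    exact S.retHom_eq_zero_iff g
  | succ n ih =>
    change (∀ b, _ ∧ _) ↔ ∀ b, _ ∧ _
    rw [S.retHom_surjective.forall]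
    simp only [← retHom_star, ← retHom_addComm, ih]

/-! ### Multipermutation solutions -/

theorem permGroup_eq_zero_of_subsingleton [Subsingleton X] (g : S.permGroup) : g = 0 :=
  Subtype.ext (Subsingleton.elim _ _)

theorem card_retraction_eq_one [Nonempty X] (h : ∀ g : S.permGroup, g = 0) :
    Nat.card (Quotient S.retSetoid) = 1 := by
  rw [Nat.card_eq_one_iff_unique]
  refine ⟨⟨?_⟩, ‹Nonempty X›.map (Quotient.mk _)⟩
  rintro ⟨x⟩ ⟨y⟩
  exact Quotient.sound (S.retSetoid_iff.mpr ((h _).trans (h _).symm))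

end

end YBSolution

namespace FiniteYBSolution

instance (S : FiniteYBSolution) : Finite S.carrier := S.finite

theorem nonempty_iterate_ret (m : ℕ) (S : FiniteYBSolution) (h : Nonempty S.carrier) :
    Nonempty (ret^[m] S).carrier := by
  induction m generalizing S with
  | zero => exact h
  | succ m ih => exact ih S.ret (h.map (Quotient.mk S.sol.retSetoid))

theorem permGroup_iterate_ret_eq_zero_iff (m : ℕ) (S : FiniteYBSolution) :
    (∀ g : (ret^[m] S).sol.permGroup, g = 0) ↔
      ∀ g : S.sol.permGroup, g ∈ SkewBrace.socleSeries S.sol.permGroup m := by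
  induction m generalizing S with
  | zero => exact Iff.rfl
  | succ m ih =>
    refine (ih S.ret).trans (S.sol.retHom_surjective.forall.trans ?_)
    exact forall_congr' fun g => S.sol.retHom_mem_socleSeries_iff m g

end FiniteYBSolution

theorem YBSolution.isMultipermutation_iff {X : Type*} [Finite X] [Nonempty X]
    (S : YBSolution X) :
    S.IsMultipermutation ↔
      ∃ n, ∀ g : S.permGroup, g ∈ SkewBrace.socleSeries S.permGroup n := by
  constructor
  · rintro ⟨m, -, hm⟩
    have := (Nat.card_eq_one_iff_unique.mp hm).1
    exact ⟨m, (FiniteYBSolution.permGroup_iterate_ret_eq_zero_iff m ⟨X, inferInstance, S⟩).mp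
      (YBSolution.permGroup_eq_zero_of_subsingleton _)⟩
  · rintro ⟨n, hn⟩
    refine ⟨n + 1, Nat.le_add_left 1 n, ?_⟩
    have := FiniteYBSolution.nonempty_iterate_ret n ⟨X, inferInstance, S⟩ ‹_›
    rw [Function.iterate_succ_apply']
    exact YBSolution.card_retraction_eq_one _
      ((FiniteYBSolution.permGroup_iterate_ret_eq_zero_iff n ⟨X, inferInstance, S⟩).mpr hn)

theorem mainTheorem2 {X Y : Type*} [Finite X] [Nonempty X] [Finite Y] [Nonempty Y]
    (r : YBSolution X) (s : YBSolution Y) (h : YBSolution.PermutationIsoclinic r s) :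
    r.IsMultipermutation ↔ s.IsMultipermutation := by
  rw [r.isMultipermutation_iff, s.isMultipermutation_iff]
  exact ⟨SkewBrace.exists_socleSeries_eq_univ_of_isoclinic h,
    SkewBrace.exists_socleSeries_eq_univ_of_isoclinic (SkewBrace.isoclinic_symm h)⟩
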